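/- For $A\subseteq\mathbb N$ and $n\ge 1$ let $\rho_n(A)=|A\cap\{0,\dots,n-1\}|/n$, and let $\underline\rho(A)=\liminf_{n\to\infty}\rho_n(A)$ be the lower density of $A$. For $r\in[0,1]$, the set $A$ is \emph{coarsely computable at density $r$} if there is a computable set $B\subseteq\mathbb N$ such that $\underline\rho(\{n : n\in A\Leftrightarrow n\in B\})\ge r$. The \emph{coarse computability bound} of $A$ is $\gamma(A)=\sup\{r\in[0,1] : A\text{ is coarsely computable at density }r\}$. A real $r$ is \emph{left-$\Sigma^0_3$} if $\{q\in\mathbb Q : q<r\}$ is a $\Sigma^0_3$ set (with respect to a standard coding of the rationals by natural numbers). Theorem. Let $0\le r\le 1$. Then the following are equivalent: (i) $r=\gamma(A)$ for some c.e. set $A\subseteq\mathbb N$; (ii) $r$ is left-$\Sigma^0_3$. -/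

import Mathlib

namespace CoarseComputability

/-- The density of `A` below `n`, i.e. `|A ∩ {0, …, n - 1}| / n`. -/
noncomputable def densityBelow (A : Set ℕ) (n : ℕ) : ℝ :=
  ((A ∩ Set.Iio n).ncard : ℝ) / (n : ℝ)

/-- The lower (asymptotic) density of `A`. -/
noncomputable def lowerDensity (A : Set ℕ) : ℝ :=
  Filter.liminf (fun n : ℕ => densityBelow A n) Filter.atTop

/-- The set of numbers on which (the characteristic functions of) `A` and `B` agree. -/
def agreement (A B : Set ℕ) : Set ℕ :=
  {n | n ∈ A ↔ n ∈ B}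

/-- `B` is an `r`-description of `A`. -/
def IsDescription (r : ℝ) (A B : Set ℕ) : Prop :=
  r ≤ lowerDensity (agreement A B)

/-- `A` is coarsely computable at density `r`: it has a computable `r`-description. -/
def CoarselyComputableAt (A : Set ℕ) (r : ℝ) : Prop :=
  ∃ B : Set ℕ, ComputablePred (fun n => n ∈ B) ∧ IsDescription r A B

/-- The coarse computability bound `γ(A)`. The set below contains `0` and is bounded by `1`. -/
noncomputable def gamma (A : Set ℕ) : ℝ :=
  sSup {r : ℝ | r ∈ Set.Icc (0 : ℝ) 1 ∧ CoarselyComputableAt A r}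

/-- `A` is computably enumerable. -/
def IsCE (A : Set ℕ) : Prop :=
  REPred (fun n => n ∈ A)

/-- `p` is a `Σ⁰₃` predicate: `p a ↔ ∃ x, ∀ y, ∃ z, R a x y z` with `R` computable. -/
def IsSigmaThree {α : Type*} [Primcodable α] (p : α → Prop) : Prop :=
  ∃ R : α × ℕ × ℕ × ℕ → Prop, ComputablePred R ∧
    ∀ a, p a ↔ ∃ x, ∀ y, ∃ z, R (a, x, y, z)

/-- The rational number `(a - b) / (c + 1)` coded by the triple `(a, b, c)`;
every rational number has a code. -/
def ratOfCode (t : ℕ × ℕ × ℕ) : ℚ :=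
  ((t.1 : ℚ) - (t.2.1 : ℚ)) / ((t.2.2 : ℚ) + 1)

/-- A set of rational numbers is `Σ⁰₃` if the set of all codes of its elements is `Σ⁰₃`. -/
def IsSigmaThreeRat (S : Set ℚ) : Prop :=
  IsSigmaThree (fun t : ℕ × ℕ × ℕ => ratOfCode t ∈ S)

/-- A real `r` is left-`Σ⁰₃` if `{q ∈ ℚ : q < r}` is `Σ⁰₃`. -/
def IsLeftSigmaThree (r : ℝ) : Prop :=
  IsSigmaThreeRat {q : ℚ | (q : ℝ) < r}

end CoarseComputability

/-!
If `A` is c.e. and `c` is real, then `c < γ(A)` if and only if there are a total code `d`, a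
rational `t > c` and a number `N` such that `d` agrees with `A` with density at least `t` below
every `n ≥ N`. For fixed `n` this can be tested at stage `s` with the stages of `A` and of `d`; the
tests settle to the truth, so each instance holds if and only if its test succeeds infinitely often,
which is `Π⁰₂`.

Conversely, let `q < r ↔ ∃ i, ∀ n, W q i n` with `W` c.e. and decreasing in `n`. A c.e. set `A` with
`γ(A) = r` is built on the intervals `[n!, (n + 1)!)`, each of which belongs to one code `e`, and
every code owns infinitely many. On the `n`-th interval, `A` copies the zeros of its code `e`, and
also contains a set of density `q` for those guesses `(q, i) ≤ e` with `W q i n`, where the set of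
density `q` increases with `q`. If a guess `(q, i)` is correct, then `A` contains its set on all
intervals but those of finitely many codes, where `A` is computable, so `γ(A) ≥ q`. If `e` is the
code of the complement of a computable set `B`, then on the later intervals of `e` only correct
guesses act, so `A` and `B` agree at most on the set of density `r`. As `n! / (n + 1)! → 0`, the
lower density of the agreement is at most `r`.
-/

namespace CoarseComputability

open Filter Topology
open Nat.Partrec (Code)
open Nat.Partrec.Code (evaln)

/-! ### Computable and computably enumerable predicates -/

section Computability

variable {α β : Type*} [Primcodable α] [Primcodable β] {p q : α → Prop}

theorem computablePred_comp {p : β → Prop} {f : α → β} (hp : ComputablePred p)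
    (hf : Computable f) : ComputablePred fun a => p (f a) := by
  classical exact (hp.decide.comp hf).computablePred

theorem computablePred_and (hp : ComputablePred p) (hq : ComputablePred q) :
    ComputablePred fun a => p a ∧ q a := by
  classical
  exact Computable.computablePred
    ((Primrec.and.to_comp.comp hp.decide hq.decide).of_eq fun a => by simp)

theorem computablePred_or (hp : ComputablePred p) (hq : ComputablePred q) :
    ComputablePred fun a => p a ∨ q a :=
  (computablePred_and hp.not hq.not).not.of_eq fun _ => by tauto

theorem computablePred_imp (hp : ComputablePred p) (hq : ComputablePred q) :
    ComputablePred fun a => p a → q a :=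
  (computablePred_or hp.not hq).of_eq fun _ => imp_iff_not_or.symm

theorem computablePred_iff (hp : ComputablePred p) (hq : ComputablePred q) :
    ComputablePred fun a => (p a ↔ q a) :=
  (computablePred_and (computablePred_imp hp hq) (computablePred_imp hq hp)).of_eq
    fun _ => iff_def.symm

theorem computablePred_lt {f g : α → ℕ} (hf : Computable f) (hg : Computable g) :
    ComputablePred fun a => f a < g a :=
  computablePred_comp (PrimrecPred.computablePred Primrec.nat_lt) (hf.pair hg)

theorem computablePred_eq {f g : α → β} (hf : Computable f) (hg : Computable g) :
    ComputablePred fun a => f a = g a :=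
  computablePred_comp (PrimrecPred.computablePred Primrec.eq) (hf.pair hg)

theorem computablePred_of_finite {A : Set ℕ} (hA : A.Finite) : ComputablePred (· ∈ A) :=
  (((PrimrecRel.exists_mem_list Primrec.eq).comp (Primrec.const hA.toFinset.toList)
    Primrec.id).computablePred).of_eq fun x => by simp

theorem computablePred_exists_lt_const {p : ℕ → α → Prop} (h : ∀ k, ComputablePred (p k))
    (N : ℕ) : ComputablePred fun a => ∃ k < N, p k a := by
  induction N with
  | zero => exact (computablePred_lt (Computable.const 0) (Computable.const 0)).of_eq (by simp)
  | succ N ih => exact (computablePred_or ih (h N)).of_eq fun a => Nat.exists_lt_succ_right.symm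

theorem computable_add {f g : α → ℕ} (hf : Computable f) (hg : Computable g) :
    Computable fun a => f a + g a :=
  Primrec.nat_add.to_comp.comp hf hg

theorem computable_mul {f g : α → ℕ} (hf : Computable f) (hg : Computable g) :
    Computable fun a => f a * g a :=
  Primrec.nat_mul.to_comp.comp hf hg

theorem computable_sub {f g : α → ℕ} (hf : Computable f) (hg : Computable g) :
    Computable fun a => f a - g a :=
  Primrec.nat_sub.to_comp.comp hf hg

theorem computable_count {p : α → ℕ → Prop} [∀ a, DecidablePred (p a)] {f : α → ℕ}
    (hp : ComputablePred fun x : α × ℕ => p x.1 x.2) (hf : Computable f) :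
    Computable fun a => Nat.count (p a) (f a) := by
  have hd : Computable fun x : α × ℕ => decide (p x.1 x.2) := hp.decide
  have hstep : Computable₂ fun (a : α) (x : ℕ × ℕ) => x.2 + cond (decide (p a x.1)) 1 0 :=
    computable_add (Computable.snd.comp Computable.snd)
      (Computable.cond (hd.comp (Computable.fst.pair (Computable.fst.comp Computable.snd)))
        (Computable.const 1) (Computable.const 0))
  refine (Computable.nat_rec hf (Computable.const 0) hstep).of_eq fun a => ?_
  induction f a with
  | zero => simp
  | succ n ih =>
    simp only [Bool.cond_decide] at ih ⊢
    rw [ih, Nat.count_succ]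

theorem computablePred_forall_lt {p : α → ℕ → Prop} {f : α → ℕ}
    (hp : ComputablePred fun x : α × ℕ => p x.1 x.2) (hf : Computable f) :
    ComputablePred fun a => ∀ i < f a, p a i := by
  classical
  exact (computablePred_eq (computable_count hp hf) hf).of_eq fun a => Nat.count_iff_forall

theorem exists_iff_eventually_of_monotone {Q : ℕ → Prop} (hQ : Monotone Q) :
    (∃ s, Q s) ↔ ∀ᶠ s in atTop, Q s :=
  ⟨fun ⟨s, hs⟩ => (eventually_ge_atTop s).mono fun _ h => hQ h hs, fun h => h.exists⟩

theorem rePred_exists_of_computablePred {p : α → ℕ → Prop}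
    (hp : ComputablePred fun x : α × ℕ => p x.1 x.2) : REPred fun a => ∃ n, p a n := by
  classical
  have hfind : Partrec fun a => Nat.rfind fun n => Part.some (decide (p a n)) :=
    Partrec.rfind hp.decide.partrec
  refine hfind.dom_re.of_eq fun a => Nat.rfind_dom.trans (exists_congr fun n => ?_)
  exact ⟨fun h => of_decide_eq_true (Part.mem_some_iff.1 h.1).symm,
    fun h => ⟨Part.mem_some_iff.2 (decide_eq_true h).symm, fun _ => trivial⟩⟩

theorem exists_stages_of_rePred (hp : REPred p) :
    ∃ Q : ℕ → α → Prop, (ComputablePred fun x : α × ℕ => Q x.2 x.1) ∧ Monotone Q ∧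
      ∀ a, p a ↔ ∃ s, Q s a := by
  obtain ⟨c, hc⟩ := Nat.Partrec.Code.exists_code.1 hp
  refine ⟨fun s a => (evaln s c (Encodable.encode a)).isSome, ?_, fun s t hst a h => ?_,
    fun a => ?_⟩
  · exact computablePred_eq (Primrec.option_isSome.to_comp.comp
      (Nat.Partrec.Code.primrec_evaln.to_comp.comp ((Computable.snd.pair (Computable.const c)).pair
        (Computable.encode.comp Computable.fst)))) (Computable.const true)
  · obtain ⟨v, hv⟩ := Option.isSome_iff_exists.1 h
    exact Option.isSome_iff_exists.2 ⟨v, Nat.Partrec.Code.evaln_mono hst hv⟩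
  · have hdom : p a ↔ (c.eval (Encodable.encode a)).Dom := by simp [hc, Part.assert]
    simp only [hdom, Part.dom_iff_mem, Nat.Partrec.Code.evaln_complete, Option.isSome_iff_exists]
    exact exists_comm

theorem rePred_comp {p : β → Prop} {f : α → β} (hp : REPred p) (hf : Computable f) :
    REPred fun a => p (f a) :=
  Partrec.comp hp hf

theorem rePred_and (hp : REPred p) (hq : REPred q) : REPred fun a => p a ∧ q a :=
  (Partrec.bind hp (rePred_comp hq Computable.fst).to₂).dom_re.of_eq fun a => by
    simp [Part.assert]

theorem rePred_exists {p : α → ℕ → Prop} (hp : REPred fun x : α × ℕ => p x.1 x.2) :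
    REPred fun a => ∃ n, p a n := by
  obtain ⟨Q, hQ, -, hpQ⟩ := exists_stages_of_rePred hp
  have hpair : REPred fun a => ∃ m : ℕ, Q m.unpair.2 (a, m.unpair.1) :=
    rePred_exists_of_computablePred (computablePred_comp hQ
      ((Computable.fst.pair (Computable.fst.comp (Computable.unpair.comp Computable.snd))).pair
        (Computable.snd.comp (Computable.unpair.comp Computable.snd))))
  refine hpair.of_eq fun a => ⟨fun ⟨m, hm⟩ => ⟨_, (hpQ (a, _)).2 ⟨_, hm⟩⟩, fun ⟨n, hn⟩ => ?_⟩
  obtain ⟨s, hs⟩ := (hpQ (a, n)).1 hn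
  exact ⟨Nat.pair n s, by simpa using hs⟩

theorem rePred_or (hp : REPred p) (hq : REPred q) : REPred fun a => p a ∨ q a := by
  obtain ⟨P, hP, -, hpP⟩ := exists_stages_of_rePred hp
  obtain ⟨Q, hQ, -, hqQ⟩ := exists_stages_of_rePred hq
  exact (rePred_exists_of_computablePred (computablePred_or hP hQ)).of_eq fun a => by
    rw [exists_or, hpP, hqQ]

theorem rePred_forall_lt {p : α → ℕ → Prop} {f : α → ℕ}
    (hp : REPred fun x : α × ℕ => p x.1 x.2) (hf : Computable f) :
    REPred fun a => ∀ i < f a, p a i := by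
  obtain ⟨Q, hQ, hmono, hpQ⟩ := exists_stages_of_rePred hp
  have hbounded : ComputablePred fun x : α × ℕ => ∀ i < f x.1, Q x.2 (x.1, i) :=
    computablePred_forall_lt (p := fun x i => Q x.2 (x.1, i))
      (computablePred_comp hQ (((Computable.fst.comp Computable.fst).pair Computable.snd).pair
        (Computable.snd.comp Computable.fst))) (hf.comp Computable.fst)
  refine (rePred_exists_of_computablePred (p := fun a s => ∀ i < f a, Q s (a, i)) hbounded).of_eq
    fun a => ?_
  have hmono' (i : ℕ) : Monotone fun s => Q s (a, i) := fun _ _ hst h => hmono hst (a, i) h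
  have hmono_forall : Monotone fun s => ∀ i < f a, Q s (a, i) :=
    fun _ _ hst h i hi => hmono' i hst (h i hi)
  calc (∃ s, ∀ i < f a, Q s (a, i)) ↔ ∀ᶠ s in atTop, ∀ i < f a, Q s (a, i) :=
        exists_iff_eventually_of_monotone hmono_forall
    _ ↔ ∀ i < f a, ∀ᶠ s in atTop, Q s (a, i) := eventually_all_finite (Set.finite_Iio (f a))
    _ ↔ ∀ i < f a, p a i := forall₂_congr fun i _ =>
        (exists_iff_eventually_of_monotone (hmono' i)).symm.trans (hpQ (a, i)).symm

end Computability

/-! ### Σ⁰₃ predicates -/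

theorem IsSigmaThree.of_rePred {α β γ : Type*} [Primcodable α] [Denumerable β] [Denumerable γ]
    {p : α → Prop} {q : α × β × γ → Prop} (hq : REPred q)
    (h : ∀ a, p a ↔ ∃ x, ∀ y, q (a, x, y)) : IsSigmaThree p := by
  obtain ⟨Q, hQ, -, hqQ⟩ := exists_stages_of_rePred hq
  refine ⟨fun w => Q w.2.2.2 (w.1, Denumerable.ofNat β w.2.1, Denumerable.ofNat γ w.2.2.1), ?_,
    fun a => ?_⟩
  · have hx : Computable fun w : α × ℕ × ℕ × ℕ => Denumerable.ofNat β w.2.1 :=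
      (Computable.ofNat β).comp (Computable.fst.comp Computable.snd)
    have hy : Computable fun w : α × ℕ × ℕ × ℕ => Denumerable.ofNat γ w.2.2.1 :=
      (Computable.ofNat γ).comp (Computable.fst.comp (Computable.snd.comp Computable.snd))
    exact computablePred_comp hQ ((Computable.fst.pair (hx.pair hy)).pair
      (Computable.snd.comp (Computable.snd.comp Computable.snd)))
  · rw [h, (Denumerable.eqv β).symm.surjective.exists]
    refine exists_congr fun x => ?_
    rw [(Denumerable.eqv γ).symm.surjective.forall]
    exact forall_congr' fun y => hqQ _

theorem IsSigmaThree.exists_rePred_antitone {α : Type*} [Primcodable α] {p : α → Prop}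
    (hp : IsSigmaThree p) :
    ∃ W : α → ℕ → ℕ → Prop, (REPred fun w : (α × ℕ) × ℕ => W w.1.1 w.1.2 w.2) ∧
      (∀ a i, Antitone (W a i)) ∧ ∀ a, p a ↔ ∃ i, ∀ n, W a i n := by
  obtain ⟨R, hR, hpR⟩ := hp
  refine ⟨fun a i n => ∀ y < n, ∃ z, R (a, i, y, z), ?_,
    fun a i m n hmn h y hy => h y (hy.trans_le hmn), fun a => (hpR a).trans ?_⟩
  · refine rePred_forall_lt (p := fun (w : (α × ℕ) × ℕ) y => ∃ z, R (w.1.1, w.1.2, y, z))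
      (rePred_exists_of_computablePred (p := fun (w : ((α × ℕ) × ℕ) × ℕ) z =>
        R (w.1.1.1, w.1.1.2, w.2, z)) (computablePred_comp hR ?_)) Computable.snd
    have hy := (Computable.fst (α := ((α × ℕ) × ℕ) × ℕ) (β := ℕ))
    have hai := Computable.fst.comp (Computable.fst.comp hy)
    exact (Computable.fst.comp hai).pair ((Computable.snd.comp hai).pair
      ((Computable.snd.comp hy).pair Computable.snd))
  · exact exists_congr fun i => ⟨fun h n y _ => h y, fun h y => h (y + 1) y y.lt_succ_self⟩

/-! ### Stages of partial recursive functions -/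

/-- The numbers at which the partial recursive function with code `c` takes the value `0`. The
computable sets are the sets `zeroSet c` with `c` total. -/
def zeroSet (c : Code) : Set ℕ :=
  {x | 0 ∈ c.eval x}

theorem computablePred_mem_zeroSet {c : Code} (hc : ∀ x, (c.eval x).Dom) :
    ComputablePred (· ∈ zeroSet c) := by
  have heval : Computable fun x => (c.eval x).get (hc x) :=
    (Nat.Partrec.Code.eval_part.comp (Computable.const c) Computable.id).of_eq_tot
      fun x => Part.get_mem (hc x)
  exact (computablePred_eq heval (Computable.const 0)).of_eq fun x =>
    Part.get_eq_iff_mem (hc x)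

theorem exists_zeroSet_eq {B : Set ℕ} (hB : ComputablePred (· ∈ B)) :
    ∃ c : Code, (∀ x, (c.eval x).Dom) ∧ zeroSet c = B := by
  classical
  have hf : Computable fun x => cond (decide (x ∈ B)) 0 1 :=
    Computable.cond hB.decide (Computable.const 0) (Computable.const 1)
  obtain ⟨c, hc⟩ := Nat.Partrec.Code.exists_code.1 (Partrec.nat_iff.1 hf.partrec)
  refine ⟨c, fun x => by rw [hc]; trivial, Set.ext fun x => ?_⟩
  by_cases hx : x ∈ B <;> simp [zeroSet, hc, hx]

theorem computable_evaln {α : Type*} [Primcodable α] {s x : α → ℕ} {c : α → Code}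
    (hs : Computable s) (hc : Computable c) (hx : Computable x) :
    Computable fun a => evaln (s a) (c a) (x a) :=
  Nat.Partrec.Code.primrec_evaln.to_comp.comp ((hs.pair hc).pair hx)

theorem eventually_evaln {c : Code} {x : ℕ} (hx : (c.eval x).Dom) :
    ∀ᶠ s in atTop, (evaln s c x).isSome ∧ (0 ∈ evaln s c x ↔ x ∈ zeroSet c) := by
  obtain ⟨v, hv⟩ := Part.dom_iff_mem.1 hx
  obtain ⟨s₀, hs₀⟩ := Nat.Partrec.Code.evaln_complete.1 hv
  filter_upwards [eventually_ge_atTop s₀] with s hs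
  have hvs : evaln s c x = some v := Nat.Partrec.Code.evaln_mono hs hs₀
  refine ⟨by rw [hvs]; rfl, Nat.Partrec.Code.evaln_sound, fun h0 => ?_⟩
  rw [Part.mem_unique h0 hv, hvs]
  rfl

/-! ### Codes of rational numbers -/

theorem exists_ratOfCode_eq (q : ℚ) : ∃ t, ratOfCode t = q := by
  refine ⟨(q.num.toNat, (-q.num).toNat, q.den - 1), ?_⟩
  have hnum : ((q.num.toNat : ℤ) : ℚ) - (((-q.num).toNat : ℤ) : ℚ) = q.num := by
    rw [← Int.cast_sub, Int.toNat_sub_toNat_neg]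
  have hden : ((q.den - 1 : ℕ) : ℚ) + 1 = q.den := by
    exact_mod_cast Nat.sub_add_cancel q.den_pos
  rw [ratOfCode, hden]
  push_cast at hnum
  rw [hnum, Rat.num_div_den]

theorem exists_ratOfCode_btwn {x y : ℝ} (h : x < y) : ∃ t, x < ratOfCode t ∧ ratOfCode t < y := by
  obtain ⟨q, hq⟩ := exists_rat_btwn h
  obtain ⟨t, rfl⟩ := exists_ratOfCode_eq q
  exact ⟨t, hq⟩

theorem ratOfCode_lt_ratOfCode_iff {t u : ℕ × ℕ × ℕ} :
    ratOfCode t < ratOfCode u ↔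
      t.1 * (u.2.2 + 1) + u.2.1 * (t.2.2 + 1) < u.1 * (t.2.2 + 1) + t.2.1 * (u.2.2 + 1) := by
  rw [ratOfCode, ratOfCode, div_lt_div_iff₀ (by positivity) (by positivity), sub_mul, sub_mul,
    sub_lt_iff_lt_add, sub_add_eq_add_sub, lt_sub_iff_add_lt]
  norm_cast

theorem computablePred_ratOfCode_lt {α : Type*} [Primcodable α] {t u : α → ℕ × ℕ × ℕ}
    (ht : Computable t) (hu : Computable u) :
    ComputablePred fun a => ratOfCode (t a) < ratOfCode (u a) := by
  have hnum {v : α → ℕ × ℕ × ℕ} (hv : Computable v) : Computable fun a => (v a).1 :=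
    Computable.fst.comp hv
  have hneg {v : α → ℕ × ℕ × ℕ} (hv : Computable v) : Computable fun a => (v a).2.1 :=
    Computable.fst.comp (Computable.snd.comp hv)
  have hden {v : α → ℕ × ℕ × ℕ} (hv : Computable v) : Computable fun a => (v a).2.2 + 1 :=
    Computable.succ.comp (Computable.snd.comp (Computable.snd.comp hv))
  exact (computablePred_lt
    (computable_add (computable_mul (hnum ht) (hden hu)) (computable_mul (hneg hu) (hden ht)))
    (computable_add (computable_mul (hnum hu) (hden ht))
      (computable_mul (hneg ht) (hden hu)))).of_eq fun _ => ratOfCode_lt_ratOfCode_iff.symm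

/-! ### Lower density -/

open Classical in
theorem densityBelow_eq_count (A : Set ℕ) (n : ℕ) :
    densityBelow A n = (Nat.count (· ∈ A) n : ℝ) / n := by
  have hcoe : A ∩ Set.Iio n = ↑{x ∈ Finset.range n | x ∈ A} := by
    ext x
    simp [and_comm]
  rw [densityBelow, Nat.count_eq_card_filter_range, hcoe, Set.ncard_coe_finset]

open Classical in
theorem densityBelow_eq_ratOfCode (A : Set ℕ) (n : ℕ) :
    densityBelow A n = ratOfCode (Nat.count (· ∈ A) n, 0, n - 1) := by
  rw [densityBelow_eq_count, ratOfCode]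
  cases n <;> simp

theorem densityBelow_nonneg (A : Set ℕ) (n : ℕ) : 0 ≤ densityBelow A n := by
  unfold densityBelow
  positivity

theorem densityBelow_le_one (A : Set ℕ) (n : ℕ) : densityBelow A n ≤ 1 := by
  classical
  rw [densityBelow_eq_count]
  exact div_le_one_of_le₀ (by exact_mod_cast Nat.count_le _) (Nat.cast_nonneg _)

theorem densityBelow_mono {A B : Set ℕ} (h : A ⊆ B) (n : ℕ) :
    densityBelow A n ≤ densityBelow B n := by
  unfold densityBelow
  gcongr
  exact (Set.finite_Iio n).inter_of_right B

theorem densityBelow_congr {A B : Set ℕ} {n : ℕ} (h : ∀ i < n, (i ∈ A ↔ i ∈ B)) :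
    densityBelow A n = densityBelow B n := by
  have hinter : A ∩ Set.Iio n = B ∩ Set.Iio n :=
    Set.ext fun i => and_congr_left fun hi => h i hi
  rw [densityBelow, densityBelow, hinter]

theorem isBoundedUnder_ge_densityBelow (A : Set ℕ) :
    IsBoundedUnder (· ≥ ·) atTop (densityBelow A) :=
  isBoundedUnder_of ⟨0, densityBelow_nonneg A⟩

theorem isCoboundedUnder_ge_densityBelow (A : Set ℕ) :
    IsCoboundedUnder (· ≥ ·) atTop (densityBelow A) :=
  IsBoundedUnder.isCoboundedUnder_ge (isBoundedUnder_of ⟨1, densityBelow_le_one A⟩)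

theorem lowerDensity_mono {A B : Set ℕ} (h : A ⊆ B) : lowerDensity A ≤ lowerDensity B :=
  liminf_le_liminf (Eventually.of_forall (densityBelow_mono h))
    (isBoundedUnder_ge_densityBelow A) (isCoboundedUnder_ge_densityBelow B)

theorem lowerDensity_nonneg (A : Set ℕ) : 0 ≤ lowerDensity A :=
  le_liminf_of_le (isCoboundedUnder_ge_densityBelow A)
    (Eventually.of_forall (densityBelow_nonneg A))

theorem lowerDensity_le_one (A : Set ℕ) : lowerDensity A ≤ 1 :=
  liminf_le_of_frequently_le (Frequently.of_forall (densityBelow_le_one A))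
    (isBoundedUnder_ge_densityBelow A)

theorem lowerDensity_le_of_frequently_le {A : Set ℕ} {φ : ℕ → ℕ} {g : ℕ → ℝ} {r : ℝ}
    (hφ : Tendsto φ atTop atTop) (hg : Tendsto g atTop (𝓝 r))
    (h : ∃ᶠ n in atTop, densityBelow A (φ n) ≤ g n) : lowerDensity A ≤ r := by
  refine le_of_forall_gt_imp_ge_of_dense fun c hc => ?_
  have hfreq : ∃ᶠ n in atTop, densityBelow A (φ n) ≤ c :=
    (h.and_eventually (hg.eventually_le_const hc)).mono fun _ hn => hn.1.trans hn.2
  exact liminf_le_of_frequently_le (hφ.frequently hfreq) (isBoundedUnder_ge_densityBelow A)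

theorem lt_lowerDensity_iff {A : Set ℕ} {c : ℝ} :
    c < lowerDensity A ↔
      ∃ t, c < ratOfCode t ∧ ∀ᶠ n in atTop, (ratOfCode t : ℝ) ≤ densityBelow A n := by
  refine ⟨fun h => ?_, fun ⟨t, hct, ht⟩ =>
    hct.trans_le (le_liminf_of_le (isCoboundedUnder_ge_densityBelow A) ht)⟩
  obtain ⟨t, hct, ht⟩ := exists_ratOfCode_btwn h
  exact ⟨t, hct, (eventually_lt_of_lt_liminf ht (isBoundedUnder_ge_densityBelow A)).mono
    fun _ => le_of_lt⟩

theorem le_gamma {A B : Set ℕ} (hB : ComputablePred (· ∈ B)) :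
    lowerDensity (agreement A B) ≤ gamma A :=
  le_csSup ⟨1, fun _ hx => hx.1.2⟩
    ⟨⟨lowerDensity_nonneg _, lowerDensity_le_one _⟩, B, hB, le_rfl⟩

theorem lt_gamma_iff {A : Set ℕ} {c : ℝ} :
    c < gamma A ↔ ∃ B : Set ℕ, ComputablePred (· ∈ B) ∧ c < lowerDensity (agreement A B) := by
  refine ⟨fun h => ?_, fun ⟨B, hB, h⟩ => h.trans_le (le_gamma hB)⟩
  have hne : {r : ℝ | r ∈ Set.Icc (0 : ℝ) 1 ∧ CoarselyComputableAt A r}.Nonempty :=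
    ⟨0, ⟨le_rfl, zero_le_one⟩, ∅, computablePred_of_finite Set.finite_empty, lowerDensity_nonneg _⟩
  obtain ⟨r, ⟨-, B, hB, hr⟩, hcr⟩ := exists_lt_of_lt_csSup hne h
  exact ⟨B, hB, hcr.trans_le hr⟩

/-! ### Sets of prescribed density -/

/-- The set of all numbers that lie in the initial part of relative length `q` of one of the blocks
`[s², (s + 1)²)`. It has density `q` and is increasing in `q`. -/
def initialParts (q : ℝ) : Set ℕ :=
  {x | ((x - x.sqrt * x.sqrt : ℕ) : ℝ) / (2 * x.sqrt + 1) < q}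

theorem initialParts_mono : Monotone initialParts :=
  fun _ _ hpq _ hx => lt_of_lt_of_le hx hpq

theorem mem_initialParts_block {q : ℝ} {s j : ℕ} (hj : j < 2 * s + 1) :
    s * s + j ∈ initialParts q ↔ (j : ℝ) < q * (2 * s + 1) := by
  have hsqrt : (s * s + j).sqrt = s := Nat.sqrt_add_eq s (by omega)
  simp only [initialParts, Set.mem_ofPred_eq, hsqrt, Nat.add_sub_cancel_left]
  exact div_lt_iff₀ (by positivity)

open Classical in
theorem count_cast_lt (y : ℝ) (n : ℕ) : Nat.count (fun j : ℕ => (j : ℝ) < y) n = min ⌈y⌉₊ n := by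
  induction n with
  | zero => simp
  | succ n ih =>
    rw [Nat.count_succ, ih]
    simp only [← Nat.lt_ceil]
    split_ifs <;> omega

open Classical in
theorem count_initialParts_succ_sq (q : ℝ) (s : ℕ) :
    Nat.count (· ∈ initialParts q) ((s + 1) * (s + 1)) =
      Nat.count (· ∈ initialParts q) (s * s) + min ⌈q * (2 * s + 1)⌉₊ (2 * s + 1) := by
  rw [show (s + 1) * (s + 1) = s * s + (2 * s + 1) by ring, Nat.count_add, ← count_cast_lt]
  simp only [Nat.count_eq_card_filter_range]
  congr 2
  exact Finset.filter_congr fun j hj => mem_initialParts_block (Finset.mem_range.1 hj)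

open Classical in
theorem count_initialParts_sq_mem_Icc {q : ℝ} (h0 : 0 ≤ q) (h1 : q ≤ 1) (s : ℕ) :
    (Nat.count (· ∈ initialParts q) (s * s) : ℝ) ∈ Set.Icc (q * (s * s)) (q * (s * s) + s) := by
  induction s with
  | zero => simp
  | succ s ih =>
    have hle : q * (2 * s + 1) ≤ (min ⌈q * (2 * s + 1)⌉₊ (2 * s + 1) : ℕ) := by
      rw [Nat.cast_min]
      refine le_min (Nat.le_ceil _) ?_
      push_cast
      exact mul_le_of_le_one_left (by positivity) h1
    have hge : (min ⌈q * (2 * s + 1)⌉₊ (2 * s + 1) : ℕ) ≤ q * (2 * s + 1) + 1 := by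
      rw [Nat.cast_min]
      exact (min_le_left _ _).trans (Nat.ceil_lt_add_one (by positivity)).le
    rw [count_initialParts_succ_sq]
    push_cast [Set.mem_Icc] at ih hle hge ⊢
    constructor <;> linarith

theorem densityBelow_initialParts_sq_mem_Icc {q : ℝ} (h0 : 0 ≤ q) (h1 : q ≤ 1) {s : ℕ}
    (hs : 0 < s) : densityBelow (initialParts q) (s * s) ∈ Set.Icc q (q + 1 / s) := by
  classical
  have hs' : (0 : ℝ) < s := Nat.cast_pos.2 hs
  have hmul : (q + 1 / s) * (s * s) = q * (s * s) + s := by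
    rw [add_mul, one_div, inv_mul_cancel_left₀ hs'.ne']
  rw [densityBelow_eq_count, Nat.cast_mul, Set.mem_Icc, le_div_iff₀ (mul_pos hs' hs'),
    div_le_iff₀ (mul_pos hs' hs'), hmul]
  exact count_initialParts_sq_mem_Icc h0 h1 s

theorem tendsto_densityBelow_initialParts_sq {q : ℝ} (h0 : 0 ≤ q) (h1 : q ≤ 1) :
    Tendsto (fun s : ℕ => densityBelow (initialParts q) (s * s)) atTop (𝓝 q) := by
  have hupper : Tendsto (fun s : ℕ => q + 1 / (s : ℝ)) atTop (𝓝 q) := by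
    simpa using tendsto_one_div_atTop_nhds_zero_nat.const_add q
  have hmem : ∀ᶠ s : ℕ in atTop,
      densityBelow (initialParts q) (s * s) ∈ Set.Icc q (q + 1 / (s : ℝ)) :=
    (eventually_gt_atTop 0).mono fun _ => densityBelow_initialParts_sq_mem_Icc h0 h1
  exact tendsto_of_tendsto_of_tendsto_of_le_of_le' tendsto_const_nhds hupper
    (hmem.mono fun _ h => h.1) (hmem.mono fun _ h => h.2)

theorem eventually_succ_sq_le_mul {a : ℝ} (ha : 1 < a) :
    ∀ᶠ s : ℕ in atTop, (((s + 1) * (s + 1) : ℕ) : ℝ) ≤ a * (s * s : ℕ) := by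
  filter_upwards [eventually_ge_atTop 1,
    tendsto_natCast_atTop_atTop.eventually_ge_atTop (3 / (a - 1))] with s hs1 hs
  have hs1' : (1 : ℝ) ≤ s := Nat.one_le_cast.2 hs1
  have hs' : 3 ≤ s * (a - 1) := (div_le_iff₀ (sub_pos.2 ha)).1 hs
  push_cast
  nlinarith

theorem tendsto_densityBelow_initialParts {q : ℝ} (h0 : 0 ≤ q) (h1 : q ≤ 1) :
    Tendsto (densityBelow (initialParts q)) atTop (𝓝 q) := by
  classical
  simp only [funext (densityBelow_eq_count _)]
  refine tendsto_div_of_monotone_of_exists_subseq_tendsto_div _ q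
    (Nat.mono_cast.comp (Nat.count_monotone _)) fun a ha =>
      ⟨fun s => s * s, eventually_succ_sq_le_mul ha, tendsto_id.atTop_mul_atTop₀ tendsto_id, ?_⟩
  simpa only [densityBelow_eq_count] using tendsto_densityBelow_initialParts_sq h0 h1

theorem lowerDensity_initialParts {q : ℝ} (h0 : 0 ≤ q) (h1 : q ≤ 1) :
    lowerDensity (initialParts q) = q :=
  (tendsto_densityBelow_initialParts h0 h1).liminf_eq

theorem mem_initialParts_ratOfCode {t : ℕ × ℕ × ℕ} {x : ℕ} :
    x ∈ initialParts (ratOfCode t) ↔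
      ratOfCode (x - x.sqrt * x.sqrt, 0, 2 * x.sqrt) < ratOfCode t := by
  rw [initialParts, Set.mem_ofPred_eq, ← Rat.cast_lt (K := ℝ)]
  simp [ratOfCode]

theorem computablePred_mem_initialParts :
    ComputablePred fun y : (ℕ × ℕ × ℕ) × ℕ => y.2 ∈ initialParts (ratOfCode y.1) := by
  have hsqrt : Computable fun y : (ℕ × ℕ × ℕ) × ℕ => y.2.sqrt :=
    Primrec.nat_sqrt.to_comp.comp Computable.snd
  refine (computablePred_ratOfCode_lt (Computable.pair
    (computable_sub Computable.snd (computable_mul hsqrt hsqrt)) (Computable.pair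
      (Computable.const 0) (computable_mul (Computable.const 2) hsqrt))) Computable.fst).of_eq
    fun y => mem_initialParts_ratOfCode.symm

/-! ### The coarse computability bound of a limit computable set is left-Σ⁰₃ -/

section LimitComputable

/-- `A` is limit computable (equivalently, `Δ⁰₂`): it is the pointwise limit of a uniformly
computable sequence of sets. -/
def IsLimitComputable (A : Set ℕ) : Prop :=
  ∃ P : ℕ → ℕ → Prop, (ComputablePred fun y : ℕ × ℕ => P y.1 y.2) ∧
    ∀ x, ∀ᶠ s in atTop, (P s x ↔ x ∈ A)

theorem IsCE.isLimitComputable {A : Set ℕ} (hA : IsCE A) : IsLimitComputable A := by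
  obtain ⟨Q, hQ, hmono, hAQ⟩ := exists_stages_of_rePred hA
  refine ⟨Q, computablePred_comp hQ (Computable.snd.pair Computable.fst), fun x => ?_⟩
  by_cases hx : x ∈ A
  · have hmono' : Monotone fun s => Q s x := fun _ _ hst => hmono hst x
    exact ((exists_iff_eventually_of_monotone hmono').1 ((hAQ x).1 hx)).mono
      fun s hs => iff_of_true hs hx
  · exact Eventually.of_forall fun s => iff_of_false (fun hs => hx ((hAQ x).2 ⟨s, hs⟩)) hx

variable {P : ℕ → ℕ → Prop} {A : Set ℕ}

/-- The stage `s` approximation to `agreement A (zeroSet d)`, where the sets `P s` approximate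
`A`. -/
def stageAgreement (P : ℕ → ℕ → Prop) (d : Code) (s : ℕ) : Set ℕ :=
  {i | P s i ↔ 0 ∈ evaln s d i}

/-- At stage `s`, the code `d` has been seen to converge below `n` and, if `N ≤ n`, to describe
`A` with density at least `ratOfCode t` below `n`, where the sets `P s` approximate `A`. -/
def SeenDense (P : ℕ → ℕ → Prop) (d : Code) (t : ℕ × ℕ × ℕ) (N n s : ℕ) : Prop :=
  (∀ i < n, (evaln s d i).isSome) ∧
    (N ≤ n → (ratOfCode t : ℝ) ≤ densityBelow (stageAgreement P d s) n)

theorem computablePred_seenDense (hP : ComputablePred fun y : ℕ × ℕ => P y.1 y.2) {α : Type*}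
    [Primcodable α] {d : α → Code} {t : α → ℕ × ℕ × ℕ} {N n s : α → ℕ} (hd : Computable d)
    (ht : Computable t) (hN : Computable N) (hn : Computable n) (hs : Computable s) :
    ComputablePred fun a => SeenDense P (d a) (t a) (N a) (n a) (s a) := by
  classical
  have heval : Computable fun w : α × ℕ => evaln (s w.1) (d w.1) w.2 :=
    computable_evaln (hs.comp Computable.fst) (hd.comp Computable.fst) Computable.snd
  have hconv : ComputablePred fun a => ∀ i < n a, (evaln (s a) (d a) i).isSome :=
    computablePred_forall_lt (computablePred_eq (Primrec.option_isSome.to_comp.comp heval)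
      (Computable.const true)) hn
  have hagree : ComputablePred fun w : α × ℕ => w.2 ∈ stageAgreement P (d w.1) (s w.1) :=
    computablePred_iff (computablePred_comp hP ((hs.comp Computable.fst).pair Computable.snd))
      (computablePred_eq heval (Computable.const (some 0)))
  have hdensity : Computable fun a =>
      (Nat.count (· ∈ stageAgreement P (d a) (s a)) (n a), 0, n a - 1) :=
    (computable_count (p := fun a i => i ∈ stageAgreement P (d a) (s a)) hagree hn).pair
      ((Computable.const 0).pair (computable_sub hn (Computable.const 1)))
  refine (computablePred_and hconv (computablePred_imp (computablePred_lt hn hN).not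
    (computablePred_ratOfCode_lt hdensity ht).not)).of_eq fun a => ?_
  rw [SeenDense, densityBelow_eq_ratOfCode, Rat.cast_le, not_lt, not_lt]

theorem frequently_seenDense_iff (hPA : ∀ x, ∀ᶠ s in atTop, (P s x ↔ x ∈ A)) {d : Code}
    {t : ℕ × ℕ × ℕ} {N n : ℕ} :
    (∃ᶠ s in atTop, SeenDense P d t N n s) ↔ (∀ i < n, (d.eval i).Dom) ∧
      (N ≤ n → (ratOfCode t : ℝ) ≤ densityBelow (agreement A (zeroSet d)) n) := by
  have hdom (h : ∃ᶠ s in atTop, SeenDense P d t N n s) : ∀ i < n, (d.eval i).Dom := by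
    obtain ⟨s, hs, -⟩ := h.exists
    intro i hi
    obtain ⟨v, hv⟩ := Option.isSome_iff_exists.1 (hs i hi)
    exact Part.dom_iff_mem.2 ⟨v, Nat.Partrec.Code.evaln_sound hv⟩
  have hsettle (h : ∀ i < n, (d.eval i).Dom) : ∀ᶠ s in atTop,
      (SeenDense P d t N n s ↔
        (N ≤ n → (ratOfCode t : ℝ) ≤ densityBelow (agreement A (zeroSet d)) n)) := by
    have hbelow : ∀ᶠ s in atTop, ∀ i < n, (evaln s d i).isSome ∧
        (i ∈ stageAgreement P d s ↔ i ∈ agreement A (zeroSet d)) := by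
      refine (eventually_all_finite (Set.finite_Iio n)).2 fun i hi => ?_
      filter_upwards [hPA i, eventually_evaln (h i hi)] with s hPs hs
      exact ⟨hs.1, iff_congr hPs hs.2⟩
    filter_upwards [hbelow] with s hs
    rw [SeenDense, densityBelow_congr fun i hi => (hs i hi).2]
    exact and_iff_right fun i hi => (hs i hi).1
  constructor
  · intro h
    obtain ⟨s, hs, hiff⟩ := (h.and_eventually (hsettle (hdom h))).exists
    exact ⟨hdom h, hiff.1 hs⟩
  · rintro ⟨h, hdense⟩
    exact ((hsettle h).mono fun s hs => hs.2 hdense).frequently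

theorem lt_gamma_iff_exists_code {c : ℝ} :
    c < gamma A ↔ ∃ (d : Code) (t : ℕ × ℕ × ℕ) (N : ℕ), c < ratOfCode t ∧
      ∀ n, (∀ i < n, (d.eval i).Dom) ∧
        (N ≤ n → (ratOfCode t : ℝ) ≤ densityBelow (agreement A (zeroSet d)) n) := by
  rw [lt_gamma_iff]
  constructor
  · rintro ⟨B, hB, hlt⟩
    obtain ⟨d, hd, rfl⟩ := exists_zeroSet_eq hB
    obtain ⟨t, hct, ht⟩ := lt_lowerDensity_iff.1 hlt
    obtain ⟨N, hN⟩ := eventually_atTop.1 ht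
    exact ⟨d, t, N, hct, fun n => ⟨fun i _ => hd i, hN n⟩⟩
  · rintro ⟨d, t, N, hct, h⟩
    refine ⟨zeroSet d, computablePred_mem_zeroSet fun x => (h (x + 1)).1 x x.lt_succ_self,
      lt_lowerDensity_iff.2 ⟨t, hct, ?_⟩⟩
    exact (eventually_ge_atTop N).mono fun n hn => (h n).2 hn

theorem rePred_exists_seenDense (hP : ComputablePred fun y : ℕ × ℕ => P y.1 y.2) :
    REPred fun w : (ℕ × ℕ × ℕ) × (Code × (ℕ × ℕ × ℕ) × ℕ) × ℕ × ℕ =>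
      ∃ s, ratOfCode w.1 < ratOfCode w.2.1.2.1 ∧ w.2.2.2 ≤ s ∧
        SeenDense P w.2.1.1 w.2.1.2.1 w.2.1.2.2 w.2.2.1 s := by
  refine rePred_exists_of_computablePred ?_
  have htail := Computable.snd.comp (Computable.fst
    (α := (ℕ × ℕ × ℕ) × (Code × (ℕ × ℕ × ℕ) × ℕ) × ℕ × ℕ) (β := ℕ))
  have hx := Computable.fst.comp htail
  have hy := Computable.snd.comp htail
  have ht := Computable.fst.comp (Computable.snd.comp hx)
  have hN := Computable.snd.comp (Computable.snd.comp hx)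
  refine computablePred_and
    (computablePred_ratOfCode_lt (Computable.fst.comp Computable.fst) ht)
    (computablePred_and ?_ (computablePred_seenDense hP (Computable.fst.comp hx) ht hN
      (Computable.fst.comp hy) Computable.snd))
  exact (computablePred_lt Computable.snd (Computable.snd.comp hy)).not.of_eq fun _ => not_lt

theorem isLeftSigmaThree_gamma (hA : IsLimitComputable A) : IsLeftSigmaThree (gamma A) := by
  obtain ⟨P, hP, hPA⟩ := hA
  refine IsSigmaThree.of_rePred (rePred_exists_seenDense hP) fun t₀ => ?_
  rw [Set.mem_ofPred_eq, lt_gamma_iff_exists_code]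
  simp only [← frequently_seenDense_iff hPA, frequently_atTop, Rat.cast_lt]
  constructor
  · rintro ⟨d, t, N, hlt, h⟩
    refine ⟨(d, t, N), fun ⟨n, u⟩ => ?_⟩
    obtain ⟨s, hus, hs⟩ := h n u
    exact ⟨s, hlt, hus, hs⟩
  · rintro ⟨⟨d, t, N⟩, h⟩
    obtain ⟨_, hlt, -⟩ := h (0, 0)
    refine ⟨d, t, N, hlt, fun n u => ?_⟩
    obtain ⟨s, -, hus, hs⟩ := h (n, u)
    exact ⟨s, hus, hs⟩

end LimitComputable

/-! ### A left-Σ⁰₃ real is the coarse computability bound of a c.e. set -/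

/-- The number `n` such that `x` lies in the interval `[n!, (n + 1)!)`; by convention `0` has
level `0`. -/
def level (x : ℕ) : ℕ :=
  Nat.findGreatest (fun n => n.factorial ≤ x) x

theorem le_level {n x : ℕ} (h : n.factorial ≤ x) : n ≤ level x :=
  Nat.le_findGreatest ((Nat.self_le_factorial n).trans h) h

theorem level_lt {n x : ℕ} (hn : 0 < n) (h : x < n.factorial) : level x < n := by
  by_contra! hle
  have hlevel : (level x).factorial ≤ x :=
    Nat.findGreatest_of_ne_zero (P := fun n => n.factorial ≤ x) rfl (hn.trans_le hle).ne'
  exact h.not_ge ((Nat.factorial_le hle).trans hlevel)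

theorem primrec_factorial : Primrec Nat.factorial := by
  have hstep : Primrec₂ fun n m : ℕ => (n + 1) * m :=
    Primrec.nat_mul.comp (Primrec.succ.comp Primrec.fst) Primrec.snd
  exact (Primrec.nat_rec₁ 1 hstep).of_eq fun n => by
    induction n with
    | zero => rfl
    | succ n ih => simp only [Nat.factorial_succ, ih]

theorem computable_level : Computable level :=
  (Primrec.nat_findGreatest (p := fun x n => n.factorial ≤ x) Primrec.id
    (Primrec.nat_le.comp (primrec_factorial.comp Primrec.snd) Primrec.fst)).to_comp

theorem densityBelow_factorial_le {A D : Set ℕ} {n : ℕ}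
    (h : ∀ x ∈ A, n.factorial ≤ x → x < (n + 1).factorial → x ∈ D) :
    densityBelow A (n + 1).factorial ≤ 1 / (n + 1) + densityBelow D (n + 1).factorial := by
  have hsub : A ∩ Set.Iio (n + 1).factorial ⊆
      Set.Iio n.factorial ∪ D ∩ Set.Iio (n + 1).factorial := by
    rintro x ⟨hx, hlt⟩
    exact (lt_or_ge x n.factorial).imp id fun hle => ⟨h x hx hle hlt, hlt⟩
  have hcard : (A ∩ Set.Iio (n + 1).factorial).ncard ≤
      n.factorial + (D ∩ Set.Iio (n + 1).factorial).ncard := by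
    refine (Set.ncard_le_ncard hsub ((Set.finite_Iio _).union
      ((Set.finite_Iio _).inter_of_right _))).trans ((Set.ncard_union_le _ _).trans_eq ?_)
    rw [Set.ncard_Iio_nat]
  have hratio : (1 : ℝ) / (n + 1) = n.factorial / (n + 1).factorial := by
    rw [Nat.factorial_succ, Nat.cast_mul, Nat.cast_succ,
      div_mul_cancel_right₀ (Nat.cast_ne_zero.2 n.factorial_ne_zero), one_div]
  rw [hratio, densityBelow, densityBelow, ← add_div]
  gcongr
  exact_mod_cast hcard

/-- The index of the code against which membership of `x` is used to diagonalize. Every index is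
the target of infinitely many levels. -/
def target (x : ℕ) : ℕ :=
  (level x).unpair.1

theorem computable_target : Computable target :=
  Computable.fst.comp (Computable.unpair.comp computable_level)

theorem frequently_unpair_fst_eq (e : ℕ) : ∃ᶠ n in atTop, (Nat.unpair n).1 = e :=
  frequently_atTop.2 fun a => ⟨Nat.pair e a, Nat.right_le_pair e a, by rw [Nat.unpair_pair]⟩

/-- The elements of `zeroSet c` up to the first divergence of `c`. Unlike `zeroSet c`, this set is
computable for every `c`, though not uniformly in `c`. -/
def guardedZeros (c : Code) : Set ℕ :=
  {x | x ∈ zeroSet c ∧ ∀ y < x, (c.eval y).Dom}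

theorem guardedZeros_eq_zeroSet {c : Code} (hc : ∀ x, (c.eval x).Dom) :
    guardedZeros c = zeroSet c :=
  Set.ext fun _ => and_iff_left fun y _ => hc y

theorem computablePred_mem_guardedZeros (c : Code) : ComputablePred (· ∈ guardedZeros c) := by
  by_cases hc : ∀ x, (c.eval x).Dom
  · rw [guardedZeros_eq_zeroSet hc]
    exact computablePred_mem_zeroSet hc
  · push Not at hc
    obtain ⟨y, hy⟩ := hc
    exact computablePred_of_finite ((Set.finite_Iic y).subset fun x hx =>
      le_of_not_gt fun hyx => hy (hx.2 y hyx))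

theorem rePred_mem_guardedZeros {α : Type*} [Primcodable α] {c : α → Code} {x : α → ℕ}
    (hc : Computable c) (hx : Computable x) : REPred fun a => x a ∈ guardedZeros (c a) := by
  have heval : Partrec fun w : α × ℕ => (c w.1).eval w.2 :=
    Nat.Partrec.Code.eval_part.comp (hc.comp Computable.fst) Computable.snd
  have hzero : REPred fun a => x a ∈ zeroSet (c a) := by
    have hstage : ComputablePred fun w : α × ℕ => evaln w.2 (c w.1) (x w.1) = some 0 :=
      computablePred_eq (computable_evaln Computable.snd (hc.comp Computable.fst)
        (hx.comp Computable.fst)) (Computable.const (some 0))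
    exact (rePred_exists_of_computablePred (p := fun a s => evaln s (c a) (x a) = some 0)
      hstage).of_eq fun a => Nat.Partrec.Code.evaln_complete.symm
  exact rePred_and hzero (rePred_forall_lt (p := fun a y => ((c a).eval y).Dom) heval.dom_re hx)

section Diagonalization

variable {R : ℕ → Set ℕ} {W : ℕ → ℕ → Prop}

/-- `strategySet R W e` is the set that is built on the levels with target `e`: it copies the zeros
of the `e`-th code, and in addition contains the sets `R k` for those `k ≤ e` that look correct on
the level. -/
def strategySet (R : ℕ → Set ℕ) (W : ℕ → ℕ → Prop) (e : ℕ) : Set ℕ :=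
  {x | x ∈ guardedZeros (Denumerable.ofNat Code e) ∨ ∃ k < e + 1, x ∈ R k ∧ W k (level x)}

/-- The c.e. set whose coarse computability bound is the supremum of the densities of those sets
`R k` for which `W k n` holds for all `n`. -/
def diagonalSet (R : ℕ → Set ℕ) (W : ℕ → ℕ → Prop) : Set ℕ :=
  {x | x ∈ strategySet R W (target x)}

theorem isCE_diagonalSet (hR : ComputablePred fun y : ℕ × ℕ => y.2 ∈ R y.1)
    (hW : REPred fun y : ℕ × ℕ => W y.1 y.2) : IsCE (diagonalSet R W) := by
  have hguarded : REPred fun x => x ∈ guardedZeros (Denumerable.ofNat Code (target x)) :=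
    rePred_mem_guardedZeros ((Computable.ofNat Code).comp computable_target) Computable.id
  have hlimit : REPred fun x => ∃ k < target x + 1, x ∈ R k ∧ W k (level x) := by
    refine rePred_exists (rePred_and (computablePred_lt Computable.snd (computable_add
      (computable_target.comp Computable.fst) (Computable.const 1))).to_re (rePred_and ?_ ?_))
    · exact (computablePred_comp hR (Computable.snd.pair Computable.fst)).to_re
    · exact rePred_comp hW (Computable.snd.pair (computable_level.comp Computable.fst))
  exact rePred_or hguarded hlimit

theorem computablePred_mem_and_level (hR : ∀ k, ComputablePred (· ∈ R k))
    (hW : ∀ k, Antitone (W k)) (k : ℕ) : ComputablePred fun x => x ∈ R k ∧ W k (level x) := by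
  by_cases h : ∀ n, W k n
  · exact (hR k).of_eq fun x => (and_iff_left (h _)).symm
  · push Not at h
    obtain ⟨n, hn⟩ := h
    refine computablePred_of_finite (A := {x | x ∈ R k ∧ W k (level x)})
      ((Set.finite_Iio n.factorial).subset fun x hx => ?_)
    by_contra hlt
    exact hn (hW k (le_level (not_lt.1 hlt)) hx.2)

theorem computablePred_mem_strategySet (hR : ∀ k, ComputablePred (· ∈ R k))
    (hW : ∀ k, Antitone (W k)) (e : ℕ) : ComputablePred (· ∈ strategySet R W e) :=
  computablePred_or (computablePred_mem_guardedZeros _)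
    (computablePred_exists_lt_const (computablePred_mem_and_level hR hW) _)

theorem computablePred_mem_diagonalSet_and_target_lt (hR : ∀ k, ComputablePred (· ∈ R k))
    (hW : ∀ k, Antitone (W k)) (k : ℕ) :
    ComputablePred fun x => x ∈ diagonalSet R W ∧ target x < k := by
  have hstrategy (e : ℕ) : ComputablePred fun x => x ∈ strategySet R W e ∧ target x = e :=
    computablePred_and (computablePred_mem_strategySet hR hW e)
      (computablePred_eq computable_target (Computable.const e))
  refine (computablePred_exists_lt_const hstrategy k).of_eq fun x => ⟨?_, ?_⟩
  · rintro ⟨_, hlt, hx, rfl⟩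
    exact ⟨hx, hlt⟩
  · rintro ⟨hx, hlt⟩
    exact ⟨_, hlt, hx, rfl⟩

theorem lowerDensity_le_gamma_diagonalSet (hR : ∀ k, ComputablePred (· ∈ R k))
    (hW : ∀ k, Antitone (W k)) {k : ℕ} (hk : ∀ n, W k n) :
    lowerDensity (R k) ≤ gamma (diagonalSet R W) := by
  let B : Set ℕ := {x | (x ∈ diagonalSet R W ∧ target x < k) ∨ (x ∈ R k ∧ ¬ target x < k)}
  have hB : ComputablePred (· ∈ B) :=
    computablePred_or (computablePred_mem_diagonalSet_and_target_lt hR hW k)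
      (computablePred_and (hR k) (computablePred_lt computable_target (Computable.const k)).not)
  have hsub : R k ⊆ agreement (diagonalSet R W) B := by
    intro x hx
    by_cases hlt : target x < k
    · simp [agreement, B, hlt]
    · have hD : x ∈ diagonalSet R W := Or.inr ⟨k, by omega, hx, hk _⟩
      exact iff_of_true hD (Or.inr ⟨hx, hlt⟩)
  exact (lowerDensity_mono hsub).trans (le_gamma hB)

theorem eventually_forall_lt_of_antitone (hW : ∀ k, Antitone (W k)) (m : ℕ) :
    ∀ᶠ n in atTop, ∀ k < m, W k n → ∀ j, W k j := by
  refine (eventually_all_finite (Set.finite_Iio m)).2 fun k _ => ?_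
  by_cases h : ∀ j, W k j
  · exact Eventually.of_forall fun _ _ => h
  · push Not at h
    obtain ⟨j, hj⟩ := h
    exact (eventually_ge_atTop j).mono fun n hn hWn => absurd (hW k hn hWn) hj

theorem eventually_agreement_compl_strategySet_subset (hW : ∀ k, Antitone (W k)) {D : Set ℕ}
    (hD : ∀ k, (∀ n, W k n) → R k ⊆ D) {e : ℕ}
    (he : ∀ x, ((Denumerable.ofNat Code e).eval x).Dom) :
    ∀ᶠ n in atTop, ∀ x, level x = n → x ∈ agreement (strategySet R W e)
      (zeroSet (Denumerable.ofNat Code e))ᶜ → x ∈ D := by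
  filter_upwards [eventually_forall_lt_of_antitone hW (e + 1)] with n hn x hx hagree
  by_cases hzero : x ∈ zeroSet (Denumerable.ofNat Code e)
  · have hstrategy : x ∈ strategySet R W e := Or.inl (by rwa [guardedZeros_eq_zeroSet he])
    exact absurd hzero (hagree.1 hstrategy)
  · rcases hagree.2 hzero with hguarded | ⟨k, hk, hxk, hWk⟩
    · exact absurd hguarded.1 hzero
    · exact hD k (hn k hk (hx ▸ hWk)) hxk

theorem gamma_diagonalSet_le (hW : ∀ k, Antitone (W k)) {D : Set ℕ} {r : ℝ}
    (hD : ∀ k, (∀ n, W k n) → R k ⊆ D) (hr : Tendsto (densityBelow D) atTop (𝓝 r)) :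
    gamma (diagonalSet R W) ≤ r := by
  refine le_of_forall_lt fun c hc => ?_
  obtain ⟨B, hB, hcB⟩ := lt_gamma_iff.1 hc
  refine hcB.trans_le ?_
  obtain ⟨d, hd, hdB⟩ := exists_zeroSet_eq (B := Bᶜ) hB.not
  obtain ⟨e, rfl⟩ : ∃ e, Denumerable.ofNat Code e = d := ⟨_, Denumerable.ofNat_encode d⟩
  obtain rfl : B = (zeroSet (Denumerable.ofNat Code e))ᶜ := by rw [hdB, compl_compl]
  have hfactorial : Tendsto (fun n : ℕ => (n + 1).factorial) atTop atTop :=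
    tendsto_atTop_mono (fun n => n.le_succ.trans (Nat.self_le_factorial _)) tendsto_id
  have hbound : Tendsto (fun n : ℕ => 1 / ((n : ℝ) + 1) + densityBelow D (n + 1).factorial) atTop
      (𝓝 r) := by
    simpa using tendsto_one_div_add_atTop_nhds_zero_nat.add (hr.comp hfactorial)
  refine lowerDensity_le_of_frequently_le hfactorial hbound
    (((frequently_unpair_fst_eq e).and_eventually
      (eventually_agreement_compl_strategySet_subset hW hD hd)).mono fun n hn =>
      densityBelow_factorial_le fun x hx hle hlt => ?_)
  have hlevel : level x = n :=
    le_antisymm (Nat.le_of_lt_succ (level_lt n.succ_pos hlt)) (le_level hle)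
  have htarget : target x = e := by rw [target, hlevel, hn.1]
  subst htarget
  exact hn.2 x hlevel hx

theorem exists_isCE_eq_gamma_of_tendsto (hR : ComputablePred fun y : ℕ × ℕ => y.2 ∈ R y.1)
    (hW : REPred fun y : ℕ × ℕ => W y.1 y.2) (hanti : ∀ k, Antitone (W k)) {D : Set ℕ} {r : ℝ}
    (hD : ∀ k, (∀ n, W k n) → R k ⊆ D) (hr : Tendsto (densityBelow D) atTop (𝓝 r))
    (hsup : ∀ c < r, ∃ k, (∀ n, W k n) ∧ c ≤ lowerDensity (R k)) :
    ∃ A : Set ℕ, IsCE A ∧ r = gamma A := by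
  have hR' (k : ℕ) : ComputablePred (· ∈ R k) :=
    computablePred_comp (f := fun x => (k, x)) hR ((Computable.const k).pair Computable.id)
  refine ⟨diagonalSet R W, isCE_diagonalSet hR hW, le_antisymm
    (le_of_forall_lt_imp_le_of_dense fun c hc => ?_) (gamma_diagonalSet_le hanti hD hr)⟩
  obtain ⟨k, hk, hck⟩ := hsup c hc
  exact hck.trans (lowerDensity_le_gamma_diagonalSet hR' hanti hk)

end Diagonalization

theorem IsLeftSigmaThree.exists_isCE_eq_gamma {r : ℝ} (h0 : 0 ≤ r) (h1 : r ≤ 1)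
    (hr : IsLeftSigmaThree r) : ∃ A : Set ℕ, IsCE A ∧ r = gamma A := by
  obtain ⟨W, hW, hanti, hrW⟩ := hr.exists_rePred_antitone
  obtain ⟨code, hcode, hsurj⟩ :
      ∃ code : ℕ → (ℕ × ℕ × ℕ) × ℕ, Computable code ∧ Function.Surjective code :=
    ⟨Denumerable.ofNat _, Computable.ofNat _, fun w => ⟨_, Denumerable.ofNat_encode w⟩⟩
  refine exists_isCE_eq_gamma_of_tendsto (D := initialParts r)
    (R := fun k => initialParts (ratOfCode (code k).1))
    (W := fun k => W (code k).1 (code k).2) ?_ ?_ (fun k => hanti _ _) (fun k hk => ?_)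
    (tendsto_densityBelow_initialParts h0 h1) fun c hc => ?_
  · exact computablePred_comp computablePred_mem_initialParts
      ((Computable.fst.comp (hcode.comp Computable.fst)).pair Computable.snd)
  · exact rePred_comp hW ((hcode.comp Computable.fst).pair Computable.snd)
  · exact initialParts_mono (le_of_lt ((hrW _).2 ⟨_, hk⟩))
  · obtain ⟨t, hct, htr⟩ := exists_ratOfCode_btwn hc
    obtain ⟨i, hi⟩ := (hrW t).1 htr
    obtain ⟨k, hk⟩ := hsurj (t, i)
    refine ⟨k, by rwa [hk], ?_⟩
    rw [hk]
    rcases le_or_gt 0 c with hc0 | hc0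
    · rw [lowerDensity_initialParts (hc0.trans hct.le) (htr.le.trans h1)]
      exact hct.le
    · exact hc0.le.trans (lowerDensity_nonneg _)

end CoarseComputability

theorem theorem6p2 (r : ℝ) (h0 : 0 ≤ r) (h1 : r ≤ 1) :
    (∃ A : Set ℕ, CoarseComputability.IsCE A ∧ r = CoarseComputability.gamma A) ↔
      CoarseComputability.IsLeftSigmaThree r := by
  refine ⟨?_, CoarseComputability.IsLeftSigmaThree.exists_isCE_eq_gamma h0 h1⟩
  rintro ⟨A, hA, rfl⟩
  exact CoarseComputability.isLeftSigmaThree_gamma hA.isLimitComputable
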